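/- Let $M_1,M_2,\dots$ be i.i.d. random variables in $[0,1]$ with cumulative distribution function $F$, and let $V_1,V_2,\dots$ be i.i.d. random variables in $[0,1]$ with mean $v$, the two sequences being independent. In round $t$ of a repeated first-price auction the bidder submits a bid $B_t\in[0,1]$; if $M_t\le B_t$ she wins, observes $V_t$ and pays $B_t$; otherwise she does not observe $V_t$. Put $U_{v,F}(b)=(v-b)F(b)$, let $b^*=\max\{\operatorname{argmax}_{b\in[0,1]}U_{v,F}(b)\}$ be the largest optimal bid, and let $$R_T^{v,F}=T\max_{b\in[0,1]}U_{v,F}(b)-\sum_{t=1}^T\mathbb E[U_{v,F}(B_t)]$$ be the (pseudo-)regret. The strategy UCBid1 with parameter $\gamma>0$, which knows $F$, bids $B_1=1$ and, for $t\ge2$, $$B_t=\max\Big\{\operatorname*{argmax}_{b\in[0,1]}\,(\hat V_t+\epsilon_t-b)F(b)\Big\},$$ where $N_t=\sum_{s=1}^{t-1}\mathbf 1\{M_s\le B_s\}$, $\hat V_t=\frac1{N_t}\sum_{s=1}^{t-1}V_s\mathbf 1\{M_s\le B_s\}$ and $\epsilon_t=\sqrt{\gamma\log(t-1)/(2N_t)}$.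 Assume that $F(b^*)>0$ and that: 1. $F$ is continuously differentiable and strictly log-concave on $[0,1]$; 2. with $f=F'$ the density of $F$ (one-sided derivatives at $0$ and $1$, and $f=0$ outside $[0,1]$), there are constants $0<c_f<C_f$, $\Delta>0$ and $\lambda\ge0$ such that $c_f<f(b)<C_f$ for all $b\in[b^*-\Delta,b^*+\Delta]$, and $\phi_F(b)=b+F(b)/f(b)$ has on $[b^*,b^*+\Delta]$ a derivative bounded above by $\lambda$. Then, for every $\gamma>1$, the regret of UCBid1 satisfies $$R_T^{v,F}\le\frac{2\gamma\lambda C_f^2}{F(b^*)\,c_f}\log^2T+O(\log T),$$ that is, there is a constant $K$, depending only on $v$, $F$, $\gamma$, $c_f$, $C_f$, $\Delta$, $\lambda$ (and not on $T$ or on the law of the $V_t$), such that $R_T^{v,F}\le\frac{2\gamma\lambda C_f^2}{F(b^*)c_f}\log^2T+K\log T$ for all $T\ge2$. -/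

import Mathlib

open MeasureTheory ProbabilityTheory

namespace FirstPrice

/-- Expected utility of the bid `b` when the item has mean value `v` and the highest competing bid
has cumulative distribution function `F`. -/
noncomputable def utility (v : ℝ) (F : ℝ → ℝ) (b : ℝ) : ℝ := (v - b) * F b

/-- The set of maximizers over `[0,1]` of `b ↦ (w - b) F(b)`. -/
def argmaxUtility (F : ℝ → ℝ) (w : ℝ) : Set ℝ :=
  {b | b ∈ Set.Icc (0 : ℝ) 1 ∧ IsMaxOn (utility w F) (Set.Icc (0 : ℝ) 1) b}

/-- The largest maximizer over `[0,1]` of `b ↦ (w - b) F(b)`. The supremum is a maximum as soon as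
`F` is continuous on `[0,1]`. -/
noncomputable def optimalBid (F : ℝ → ℝ) (w : ℝ) : ℝ := sSup (argmaxUtility F w)

/-- For a continuous `F`, `optimalBid F w` really is the largest maximizer. -/
theorem isGreatest_optimalBid {F : ℝ → ℝ} (hF : ContinuousOn F (Set.Icc (0 : ℝ) 1)) (w : ℝ) :
    IsGreatest (argmaxUtility F w) (optimalBid F w) := by
  have hU : ContinuousOn (utility w F) (Set.Icc (0 : ℝ) 1) :=
    ContinuousOn.mul (by fun_prop) hF
  obtain ⟨x, hx, hmax⟩ := isCompact_Icc.exists_isMaxOn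
    (Set.nonempty_Icc.2 (zero_le_one (α := ℝ))) hU
  have hset : argmaxUtility F w =
      Set.Icc (0 : ℝ) 1 ∩ utility w F ⁻¹' Set.Ici (utility w F x) := by
    ext b
    constructor
    · rintro ⟨hb, hm⟩
      exact ⟨hb, hm hx⟩
    · rintro ⟨hb, hm⟩
      have hm2 : utility w F x ≤ utility w F b := hm
      refine ⟨hb, fun y hy => ?_⟩
      have hy2 : utility w F y ≤ utility w F x := hmax hy
      exact le_trans hy2 hm2
  have hclosed : IsClosed (argmaxUtility F w) := by
    rw [hset]
    exact hU.preimage_isClosed_of_isClosed isClosed_Icc isClosed_Ici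
  have hcomp : IsCompact (argmaxUtility F w) :=
    isCompact_Icc.of_isClosed_subset hclosed fun b hb => hb.1
  exact hcomp.isGreatest_sSup ⟨x, hx, hmax⟩

/-- Strict log-concavity of a nonnegative function on a convex set `s`; the multiplicative form
covers points where the function vanishes. -/
def StrictLogConcaveOn (s : Set ℝ) (F : ℝ → ℝ) : Prop :=
  ∀ x ∈ s, ∀ y ∈ s, x ≠ y → ∀ a b : ℝ, 0 < a → 0 < b → a + b = 1 →
    F x ^ a * F y ^ b < F (a * x + b * y)

/-- The derivative of `F` on `[0,1]` (one-sided at the endpoints, and `0` off `[0,1]`). -/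
noncomputable def density (F : ℝ → ℝ) (b : ℝ) : ℝ := derivWithin F (Set.Icc (0 : ℝ) 1) b

/-- `φ_F(b) = b + F(b) / f(b)`. -/
noncomputable def virtualValue (F : ℝ → ℝ) (b : ℝ) : ℝ := b + F b / density F b

/-- `F` is continuously differentiable and strictly log-concave on `[0,1]`. -/
structure PseudoMHR (F : ℝ → ℝ) : Prop where
  contDiffOn : ContDiffOn ℝ 1 F (Set.Icc (0 : ℝ) 1)
  strictLogConcaveOn : StrictLogConcaveOn (Set.Icc (0 : ℝ) 1) F

/-- Local regularity around the optimal bid `b*`: the density is strictly between `c > 0` and `C` on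
`[b* - Δ, b* + Δ]`, and `φ_F` has a derivative bounded above by `lam` on `[b*, b* + Δ]`. -/
structure LocallyRegular (F : ℝ → ℝ) (v c C Δ lam : ℝ) : Prop where
  c_pos : 0 < c
  Δ_pos : 0 < Δ
  lam_nonneg : 0 ≤ lam
  density_bounds : ∀ b ∈ Set.Icc (optimalBid F v - Δ) (optimalBid F v + Δ),
    c < density F b ∧ density F b < C
  differentiableOn :
    DifferentiableOn ℝ (virtualValue F) (Set.Icc (optimalBid F v) (optimalBid F v + Δ))
  deriv_le : ∀ b ∈ Set.Icc (optimalBid F v) (optimalBid F v + Δ),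
    derivWithin (virtualValue F) (Set.Icc (optimalBid F v) (optimalBid F v + Δ)) b ≤ lam

/-! Rounds are numbered from `0`: index `t` below is round `t + 1` of the auction, so `Finset.range t`
is the set of rounds strictly before it. `B`, `M`, `V` are the realized bids, highest competing bids
and values. -/

/-- Number of auctions won, hence of values observed, before round `t`. -/
noncomputable def numObs (B M : ℕ → ℝ) (t : ℕ) : ℕ :=
  ∑ s ∈ Finset.range t, if M s ≤ B s then 1 else 0

/-- Average of the values observed before round `t`. -/
noncomputable def empMean (B M V : ℕ → ℝ) (t : ℕ) : ℝ :=
  (∑ s ∈ Finset.range t, if M s ≤ B s then V s else 0) / (numObs B M t : ℝ)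

/-- Confidence bonus `√(γ log t / (2 N_t))`; `t` is the number of rounds already played. -/
noncomputable def bonus (γ : ℝ) (B M : ℕ → ℝ) (t : ℕ) : ℝ :=
  Real.sqrt (γ * Real.log t / (2 * (numObs B M t : ℝ)))

/-- The bids of UCBid1 along the realization `V`, `M`: bid `1` first, then the largest maximizer of
`b ↦ (empMean + bonus - b) F(b)`. Only earlier bids enter the statistics, so the value `0` given to
the later ones plays no role; see `ucbid1_succ`. -/
noncomputable def ucbid1 (F : ℝ → ℝ) (γ : ℝ) (V M : ℕ → ℝ) : ℕ → ℝ
  | 0 => 1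
  | t + 1 =>
    let past : ℕ → ℝ := fun s => if _h : s < t + 1 then ucbid1 F γ V M s else 0
    optimalBid F (empMean past M V (t + 1) + bonus γ past M (t + 1))

theorem ucbid1_zero (F : ℝ → ℝ) (γ : ℝ) (V M : ℕ → ℝ) : ucbid1 F γ V M 0 = 1 := by
  rw [ucbid1]

theorem ucbid1_succ (F : ℝ → ℝ) (γ : ℝ) (V M : ℕ → ℝ) (t : ℕ) :
    ucbid1 F γ V M (t + 1) =
      optimalBid F (empMean (ucbid1 F γ V M) M V (t + 1) + bonus γ (ucbid1 F γ V M) M (t + 1)) := by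
  have hN : numObs (fun s => if _h : s < t + 1 then ucbid1 F γ V M s else 0) M (t + 1) =
      numObs (ucbid1 F γ V M) M (t + 1) := by
    unfold numObs
    refine Finset.sum_congr rfl fun s hs => ?_
    simp [Finset.mem_range.1 hs]
  have hV : empMean (fun s => if _h : s < t + 1 then ucbid1 F γ V M s else 0) M V (t + 1) =
      empMean (ucbid1 F γ V M) M V (t + 1) := by
    unfold empMean
    rw [hN]
    congr 1
    refine Finset.sum_congr rfl fun s hs => ?_
    simp [Finset.mem_range.1 hs]
  rw [ucbid1]
  simp only [bonus, hN, hV]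

/-- The stochastic environment: the values `V t` are i.i.d. in `[0,1]` with mean `v`, the highest
competing bids `M t` are i.i.d. with law `μ`, and the two sequences are independent. -/
structure IsEnvironment {Ω : Type*} [MeasurableSpace Ω] (P : Measure Ω) (v : ℝ) (μ : Measure ℝ)
    (V M : ℕ → Ω → ℝ) : Prop where
  measurable_V : ∀ t, Measurable (V t)
  measurable_M : ∀ t, Measurable (M t)
  V_mem : ∀ t, ∀ᵐ ω ∂P, V t ω ∈ Set.Icc (0 : ℝ) 1
  identDistrib_V : ∀ t, IdentDistrib (V t) (V 0) P P
  mean_V : ∀ t, ∫ ω, V t ω ∂P = v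
  law_M : ∀ t, P.map (M t) = μ
  iIndep_V : iIndepFun V P
  iIndep_M : iIndepFun M P
  indep_V_M : IndepFun (fun ω t => V t ω) (fun ω t => M t ω) P

/-- The (pseudo-)regret after `T` rounds of the random bids `B 0, …, B (T - 1)`. -/
noncomputable def regret {Ω : Type*} [MeasurableSpace Ω] (P : Measure Ω) (v : ℝ) (F : ℝ → ℝ)
    (B : ℕ → Ω → ℝ) (T : ℕ) : ℝ :=
  (T : ℝ) * sSup (utility v F '' Set.Icc (0 : ℝ) 1) -
    ∑ t ∈ Finset.range T, ∫ ω, utility v F (B t ω) ∂P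

/-- The bids of UCBid1 as random variables. -/
noncomputable def ucbid1Process {Ω : Type*} (F : ℝ → ℝ) (γ : ℝ) (V M : ℕ → Ω → ℝ) (t : ℕ) (ω : Ω) :
    ℝ :=
  ucbid1 F γ (fun s => V s ω) (fun s => M s ω) t

end FirstPrice

/-! Off a rare event, the bid of UCBid1 is the largest optimal bid for some value in [v, v + 2ε],
where ε is the bonus. It remains to bound the cost of such a bid and the size of ε.

Cost. Log-concavity makes the largest optimal bid increase no faster than the value
(`optimalBid_sub_le`), so the overbid is at most 2ε. Since U' = (v - φ_F) f vanishes at b* and φ_F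
grows there at rate at most λ, the loss is at most C_f λ (2ε)² / 2
(`LocallyRegular.utility_sub_le`).

Size of ε. Values are seen only after a win, but V_t is independent of the earlier values and of all
competing bids, so the compensated exponential of the observed deviations keeps expectation at most
1 (`IsEnvironment.lintegral_expDeviation_le`). A geometric grid of exponents handles the random N_t
(`exists_peel`), and for γ > 1 the failure probabilities are summable. Hence the expected number of
underbids is finite. A bid of at least b* wins whenever M_t ≤ b*, so N_t ≥ F(b*) t / 2 outside an
event of probability O(1/t) (`IsEnvironment.measure_numObs_lt_le`), and ε² ≤ γ log t / (F(b*) t).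
The loss of a late round is at most a multiple of log t / t, plus O(1/t), plus a summable term;
summation gives log² T + O(log T). -/

namespace FirstPrice

/-! ### Optimal bids and the local quadratic loss -/

section Deterministic

variable {F : ℝ → ℝ}

theorem optimalBid_mem (hF : ContinuousOn F (Set.Icc (0 : ℝ) 1)) (w : ℝ) :
    optimalBid F w ∈ Set.Icc (0 : ℝ) 1 := (isGreatest_optimalBid hF w).1.1

theorem utility_le_utility_optimalBid (hF : ContinuousOn F (Set.Icc (0 : ℝ) 1)) (w : ℝ) {b : ℝ}
    (hb : b ∈ Set.Icc (0 : ℝ) 1) : utility w F b ≤ utility w F (optimalBid F w) :=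
  (isGreatest_optimalBid hF w).1.2 hb

/-- The largest optimal bid is nondecreasing in the value. -/
theorem monotone_optimalBid (hF : ContinuousOn F (Set.Icc (0 : ℝ) 1)) (hmono : Monotone F) :
    Monotone (optimalBid F) := by
  intro v w hvw
  by_contra! hlt
  -- Passing from v to w adds (w - v) F(b), nondecreasing in b, so the larger bid would stay optimal
  -- at w.
  have hmem : optimalBid F v ∈ argmaxUtility F w := by
    refine ⟨optimalBid_mem hF v, fun b hb => ?_⟩
    have h1 : utility w F b ≤ utility w F (optimalBid F w) :=
      utility_le_utility_optimalBid hF w hb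
    have h2 := utility_le_utility_optimalBid hF v (optimalBid_mem hF w)
    have h3 := hmono hlt.le
    show utility w F b ≤ utility w F (optimalBid F v)
    unfold utility at *
    nlinarith
  exact absurd ((isGreatest_optimalBid hF w).2 hmem) (not_le.2 hlt)

/-- Moving two points towards each other increases the product of the values of a log-concave
function. -/
theorem StrictLogConcaveOn.mul_le_mul {s : Set ℝ} (h : StrictLogConcaveOn s F)
    (hnn : ∀ x, 0 ≤ F x) {x y d : ℝ} (hx : x ∈ s) (hy : y ∈ s) (hd : 0 < d) (hxy : d < y - x) :
    F y * F x ≤ F (y - d) * F (x + d) := by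
  have hpos : 0 < y - x := hd.trans hxy
  set a := d / (y - x) with ha
  have ha0 : 0 < a := div_pos hd hpos
  have ha1 : a < 1 := (div_lt_one hpos).2 hxy
  have had : a * (y - x) = d := div_mul_cancel₀ _ hpos.ne'
  have hne : x ≠ y := by intro h; simp [h] at hpos
  -- The same weight is used twice with the roles of x and y swapped, so that in the product the
  -- exponents of each value of `F` sum to 1.
  have h1 := h x hx y hy hne a (1 - a) ha0 (by linarith) (by ring)
  have h2 := h x hx y hy hne (1 - a) a (by linarith) ha0 (by ring)
  have e1 : a * x + (1 - a) * y = y - d := by linear_combination -had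
  have e2 : (1 - a) * x + a * y = x + d := by linear_combination had
  rw [e1] at h1
  rw [e2] at h2
  have hsplit : ∀ z, F z ^ a * F z ^ (1 - a) = F z := fun z => by
    rw [← Real.rpow_add_of_nonneg (hnn z) ha0.le (by linarith)]; simp
  calc F y * F x = (F x ^ a * F y ^ (1 - a)) * (F x ^ (1 - a) * F y ^ a) := by
        conv_lhs => rw [← hsplit y, ← hsplit x]
        ring
    _ ≤ _ := _root_.mul_le_mul h1.le h2.le
        (mul_nonneg (Real.rpow_nonneg (hnn _) _) (Real.rpow_nonneg (hnn _) _)) (hnn _)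

/-- For a log-concave `F`, the largest optimal bid is `1`-Lipschitz from above. -/
theorem optimalBid_sub_le (hF : ContinuousOn F (Set.Icc (0 : ℝ) 1)) (hmono : Monotone F)
    (hnn : ∀ x, 0 ≤ F x) (hlog : StrictLogConcaveOn (Set.Icc (0 : ℝ) 1) F) {v w : ℝ}
    (hvw : v ≤ w) (hpos : 0 < F (optimalBid F v)) (hv : optimalBid F v < v) :
    optimalBid F w - optimalBid F v ≤ w - v := by
  set x := optimalBid F v with hx
  set y := optimalBid F w with hy
  have hxm : x ∈ Set.Icc (0 : ℝ) 1 := optimalBid_mem hF v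
  have hym : y ∈ Set.Icc (0 : ℝ) 1 := optimalBid_mem hF w
  have hxy : x ≤ y := monotone_optimalBid hF hmono hvw
  have hFy : 0 < F y := hpos.trans_le (hmono hxy)
  have hwy : 0 < w - y := by
    have h1 : utility w F x ≤ utility w F y := utility_le_utility_optimalBid hF w hxm
    unfold utility at h1
    have h2 : 0 < (w - x) * F x := mul_pos (by linarith) hpos
    exact pos_of_mul_pos_left (h2.trans_le h1) hFy.le
  by_contra! hcon
  have hgap : 0 < y - x := by linarith
  -- If y - x > w - v, move both bids inwards by d < δ. The two optimality inequalities multiply,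
  -- log-concavity removes `F`, and (w - y + d)(v - x - d) ≤ (w - y)(v - x) remains, although the
  -- difference of the two sides is d(δ - d) > 0.
  set δ := (v - x) - (w - y) with hδ
  have hδ0 : 0 < δ := by linarith
  obtain ⟨d, hd0, hd1, hd2⟩ : ∃ d, 0 < d ∧ d < δ ∧ d < y - x :=
    ⟨min δ (y - x) / 2, by positivity,
      by have := min_le_left δ (y - x); linarith, by have := min_le_right δ (y - x); linarith⟩
  have h1 : utility w F (y - d) ≤ utility w F y :=
    utility_le_utility_optimalBid hF w ⟨by linarith [hxm.1], by linarith [hym.2]⟩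
  have h2 : utility v F (x + d) ≤ utility v F x :=
    utility_le_utility_optimalBid hF v ⟨by linarith [hxm.1], by linarith [hym.2]⟩
  unfold utility at h1 h2
  have h3 := hlog.mul_le_mul hnn hxm hym hd0 hd2
  have hq : 0 < v - x - d := by linarith
  have h4 := _root_.mul_le_mul h1 h2 (mul_nonneg (by linarith) (hnn _))
    (mul_nonneg hwy.le hFy.le)
  have h5 : (w - y + d) * (v - x - d) * (F y * F x) ≤ (w - y) * (v - x) * (F y * F x) := by
    calc (w - y + d) * (v - x - d) * (F y * F x)
        ≤ (w - y + d) * (v - x - d) * (F (y - d) * F (x + d)) :=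
          mul_le_mul_of_nonneg_left h3 (by positivity)
      _ ≤ _ := by linarith
  have h6 := le_of_mul_le_mul_right h5 (mul_pos hFy hpos)
  nlinarith [mul_pos hd0 (sub_pos.2 hd1)]

variable {v c C Δ lam : ℝ}

theorem density_eq_zero_of_notMem {b : ℝ} (hb : b ∉ Set.Icc (0 : ℝ) 1) : density F b = 0 :=
  derivWithin_zero_of_notMem_closure (by rwa [isClosed_Icc.closure_eq])

/-- The density is set to 0 off [0,1], so its positive lower bound confines the window to [0,1]. In
particular b* is an interior maximizer. -/
theorem LocallyRegular.mem_Icc (h : LocallyRegular F v c C Δ lam) {b : ℝ}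
    (hb : b ∈ Set.Icc (optimalBid F v - Δ) (optimalBid F v + Δ)) : b ∈ Set.Icc (0 : ℝ) 1 := by
  by_contra hcon
  have := (h.density_bounds b hb).1
  rw [density_eq_zero_of_notMem hcon] at this
  exact absurd this (not_lt.2 h.c_pos.le)

theorem LocallyRegular.optimalBid_bounds (h : LocallyRegular F v c C Δ lam) :
    0 ≤ optimalBid F v - Δ ∧ optimalBid F v + Δ ≤ 1 := by
  have hΔ := h.Δ_pos
  exact ⟨(h.mem_Icc (Set.left_mem_Icc.2 (by linarith))).1,
    (h.mem_Icc (Set.right_mem_Icc.2 (by linarith))).2⟩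

theorem hasDerivAt_density (hF : ContDiffOn ℝ 1 F (Set.Icc (0 : ℝ) 1)) {b : ℝ}
    (hb : b ∈ Set.Ioo (0 : ℝ) 1) : HasDerivAt F (density F b) b :=
  (hF.differentiableOn one_ne_zero b (Set.Ioo_subset_Icc_self hb)).hasDerivWithinAt.hasDerivAt
    (Icc_mem_nhds hb.1 hb.2)

theorem hasDerivAt_utility (hF : ContDiffOn ℝ 1 F (Set.Icc (0 : ℝ) 1)) (v : ℝ) {b : ℝ}
    (hb : b ∈ Set.Ioo (0 : ℝ) 1) :
    HasDerivAt (utility v F) (-1 * F b + (v - b) * density F b) b :=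
  ((hasDerivAt_id b).const_sub v).mul (hasDerivAt_density hF hb)

theorem LocallyRegular.density_optimalBid (h : LocallyRegular F v c C Δ lam) :
    c < density F (optimalBid F v) ∧ density F (optimalBid F v) < C :=
  h.density_bounds _ ⟨by linarith [h.Δ_pos], by linarith [h.Δ_pos]⟩

/-- First-order condition at the optimal bid. -/
theorem LocallyRegular.first_order (h : LocallyRegular F v c C Δ lam)
    (hF : ContDiffOn ℝ 1 F (Set.Icc (0 : ℝ) 1)) :
    (v - optimalBid F v) * density F (optimalBid F v) = F (optimalBid F v) := by
  have hb := h.optimalBid_bounds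
  have hΔ := h.Δ_pos
  have hI : optimalBid F v ∈ Set.Ioo (0 : ℝ) 1 := ⟨by linarith, by linarith⟩
  have hmax : IsLocalMax (utility v F) (optimalBid F v) :=
    (isGreatest_optimalBid hF.continuousOn v).1.2.isLocalMax (Icc_mem_nhds hI.1 hI.2)
  have := hmax.hasDerivAt_eq_zero (hasDerivAt_utility hF v hI)
  linarith

theorem LocallyRegular.virtualValue_optimalBid (h : LocallyRegular F v c C Δ lam)
    (hF : ContDiffOn ℝ 1 F (Set.Icc (0 : ℝ) 1)) : virtualValue F (optimalBid F v) = v := by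
  have hd : density F (optimalBid F v) ≠ 0 := (h.c_pos.trans h.density_optimalBid.1).ne'
  rw [virtualValue, ← h.first_order hF, mul_div_cancel_right₀ _ hd]
  ring

theorem LocallyRegular.optimalBid_lt (h : LocallyRegular F v c C Δ lam)
    (hF : ContDiffOn ℝ 1 F (Set.Icc (0 : ℝ) 1)) (hpos : 0 < F (optimalBid F v)) :
    optimalBid F v < v := by
  have hd : 0 < density F (optimalBid F v) := h.c_pos.trans h.density_optimalBid.1
  have := h.first_order hF
  have h2 : 0 < v - optimalBid F v := pos_of_mul_pos_left (this ▸ hpos) hd.le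
  linarith

theorem LocallyRegular.C_pos (h : LocallyRegular F v c C Δ lam) : 0 < C :=
  h.c_pos.trans (h.density_optimalBid.1.trans h.density_optimalBid.2)

theorem LocallyRegular.c_lt_C (h : LocallyRegular F v c C Δ lam) : c < C :=
  h.density_optimalBid.1.trans h.density_optimalBid.2

theorem LocallyRegular.virtualValue_le (h : LocallyRegular F v c C Δ lam)
    (hF : ContDiffOn ℝ 1 F (Set.Icc (0 : ℝ) 1)) {b : ℝ}
    (hb : b ∈ Set.Icc (optimalBid F v) (optimalBid F v + Δ)) :
    virtualValue F b ≤ v + lam * (b - optimalBid F v) := by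
  have hmono : MonotoneOn (fun x => lam * x - virtualValue F x)
      (Set.Icc (optimalBid F v) (optimalBid F v + Δ)) := by
    refine monotoneOn_of_hasDerivWithinAt_nonneg (f' := fun x => lam * 1 -
      derivWithin (virtualValue F) (Set.Icc (optimalBid F v) (optimalBid F v + Δ)) x)
      (convex_Icc _ _) ((by fun_prop : Continuous fun x : ℝ => lam * x).continuousOn.sub
        h.differentiableOn.continuousOn) (fun x hx => ?_) (fun x hx => ?_)
    · refine HasDerivWithinAt.sub (((hasDerivAt_id x).const_mul lam).hasDerivWithinAt) ?_
      exact ((h.differentiableOn x (interior_subset hx)).hasDerivWithinAt).mono interior_subset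
    · have := h.deriv_le x (interior_subset hx)
      linarith
  have := hmono (Set.left_mem_Icc.2 (by linarith [h.Δ_pos])) hb hb.1
  simp only [h.virtualValue_optimalBid hF] at this
  linarith

/-- Quadratic bound on the loss of utility of a bid slightly above the optimal one. -/
theorem LocallyRegular.utility_sub_le (h : LocallyRegular F v c C Δ lam)
    (hF : ContDiffOn ℝ 1 F (Set.Icc (0 : ℝ) 1)) {b : ℝ}
    (hb : b ∈ Set.Icc (optimalBid F v) (optimalBid F v + Δ)) :
    utility v F (optimalBid F v) - utility v F b ≤ C * lam * (b - optimalBid F v) ^ 2 / 2 := by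
  have hbd := h.optimalBid_bounds
  have hΔ := h.Δ_pos
  set x₀ := optimalBid F v with hx₀
  have hsub : Set.Icc x₀ (x₀ + Δ) ⊆ Set.Icc 0 1 :=
    Set.Icc_subset_Icc (by linarith) (by linarith)
  -- U' = (v - φ_F) f is at least -C λ (x - x₀), by `virtualValue_le` and f < C.
  have hmono : MonotoneOn (fun x => utility v F x + C * lam * (x - x₀) ^ 2 / 2)
      (Set.Icc x₀ (x₀ + Δ)) := by
    refine monotoneOn_of_hasDerivWithinAt_nonneg (f' := fun x => (-1 * F x + (v - x) * density F x) +
      C * lam * (x - x₀)) (convex_Icc _ _) ?_ (fun x hx => ?_) (fun x hx => ?_)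
    · refine ContinuousOn.add ?_ (by fun_prop)
      exact ContinuousOn.mul (by fun_prop) (hF.continuousOn.mono hsub)
    · rw [interior_Icc] at hx
      refine (HasDerivAt.add (hasDerivAt_utility hF v ⟨by linarith [hx.1], by linarith [hx.2]⟩)
        ?_).hasDerivWithinAt
      have := ((((hasDerivAt_id x).sub_const x₀).pow 2).const_mul (C * lam)).div_const 2
      refine this.congr_deriv ?_
      simp
      ring
    · have hx' := interior_subset hx
      have hd := h.density_bounds x ⟨by linarith [hx'.1], hx'.2⟩
      have hd0 : 0 < density F x := h.c_pos.trans hd.1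
      have hφ := h.virtualValue_le hF hx'
      have hFx : F x = (virtualValue F x - x) * density F x := by
        rw [virtualValue]; field_simp; ring
      rw [hFx]
      have h1 : 0 ≤ lam * (x - x₀) := mul_nonneg h.lam_nonneg (by linarith [hx'.1])
      nlinarith [mul_nonneg h1 (sub_nonneg.2 hd.2.le),
        mul_nonneg (sub_nonneg.2 hφ) hd0.le]
  have := hmono (Set.left_mem_Icc.2 (by linarith)) hb hb.1
  simp only [sub_self] at this
  linarith

/-- Loss of utility of the optimal bid for a value slightly overestimated. -/
theorem LocallyRegular.utility_sub_optimalBid_le (h : LocallyRegular F v c C Δ lam)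
    (hF : PseudoMHR F) (hmono : Monotone F) (hnn : ∀ x, 0 ≤ F x)
    (hpos : 0 < F (optimalBid F v)) {w ε : ℝ} (hvw : v ≤ w) (hw : w ≤ v + 2 * ε)
    (hε : 2 * ε ≤ Δ) :
    utility v F (optimalBid F v) - utility v F (optimalBid F w) ≤ 2 * C * lam * ε ^ 2 := by
  have h0 := monotone_optimalBid hF.contDiffOn.continuousOn hmono hvw
  have h1 := optimalBid_sub_le hF.contDiffOn.continuousOn hmono hnn hF.strictLogConcaveOn hvw hpos
    (h.optimalBid_lt hF.contDiffOn hpos)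
  have h2 := h.utility_sub_le hF.contDiffOn (b := optimalBid F w) ⟨h0, by linarith⟩
  have h3 : (optimalBid F w - optimalBid F v) ^ 2 ≤ (2 * ε) ^ 2 :=
    pow_le_pow_left₀ (by linarith) (by linarith) 2
  have h4 := mul_le_mul_of_nonneg_left h3 (mul_nonneg h.C_pos.le h.lam_nonneg)
  linarith

theorem abs_utility_le (hnn : ∀ x, 0 ≤ F x) (hle : ∀ x, F x ≤ 1) {b : ℝ}
    (hv : v ∈ Set.Icc (0 : ℝ) 1) (hb : b ∈ Set.Icc (0 : ℝ) 1) : |utility v F b| ≤ 1 := by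
  rw [utility, abs_mul, abs_of_nonneg (hnn b)]
  exact mul_le_one₀ (abs_le.2 ⟨by linarith [hv.1, hb.2], by linarith [hv.2, hb.1]⟩) (hnn b) (hle b)

end Deterministic

/-! ### Deviations along a realization -/

section Pathwise

variable {F : ℝ → ℝ} {γ : ℝ}

theorem numObs_congr {B B' : ℕ → ℝ} (M : ℕ → ℝ) {t : ℕ} (h : ∀ s < t, B s = B' s) :
    numObs B M t = numObs B' M t :=
  Finset.sum_congr rfl fun s hs => by rw [h s (Finset.mem_range.1 hs)]

/-- The bid of round `t` only depends on the values of the earlier rounds. -/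
theorem ucbid1_congr {V V' : ℕ → ℝ} (M : ℕ → ℝ) {t : ℕ} (h : ∀ s < t, V s = V' s) :
    ucbid1 F γ V M t = ucbid1 F γ V' M t := by
  induction t using Nat.strong_induction_on with
  | _ t ih =>
    cases t with
    | zero => rw [ucbid1_zero, ucbid1_zero]
    | succ t =>
      have hB : ∀ s < t + 1, ucbid1 F γ V M s = ucbid1 F γ V' M s := fun s hs =>
        ih s hs fun r hr => h r (hr.trans hs)
      have hN := numObs_congr M hB
      rw [ucbid1_succ, ucbid1_succ]
      unfold empMean bonus
      rw [hN]
      congr 3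
      refine Finset.sum_congr rfl fun s hs => ?_
      rw [hB s (Finset.mem_range.1 hs), h s (Finset.mem_range.1 hs)]

/-- Cumulated deviation from `v` of the values observed before round `t`. -/
noncomputable def obsDeviation (v : ℝ) (B M V : ℕ → ℝ) (t : ℕ) : ℝ :=
  ∑ s ∈ Finset.range t, if M s ≤ B s then V s - v else 0

theorem empMean_sub_mul_numObs (v : ℝ) (B M V : ℕ → ℝ) (t : ℕ) (hN : 1 ≤ numObs B M t) :
    (empMean B M V t - v) * numObs B M t = obsDeviation v B M V t := by
  have hN' : (numObs B M t : ℝ) ≠ 0 := by positivity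
  rw [sub_mul, empMean, div_mul_cancel₀ _ hN', numObs, obsDeviation]
  push_cast
  rw [Finset.mul_sum, ← Finset.sum_sub_distrib]
  refine Finset.sum_congr rfl fun s _ => ?_
  split_ifs <;> simp

/-- The exponential supermartingale of the observed deviations. -/
noncomputable def expDeviation (v θ : ℝ) (B M V : ℕ → ℝ) (t : ℕ) : ℝ :=
  Real.exp (θ * obsDeviation v B M V t - θ ^ 2 / 8 * numObs B M t)

/-- A lost round changes nothing; a won round brings one fresh factor, whose mean is at most 1. -/
theorem expDeviation_succ (v θ : ℝ) (B M V : ℕ → ℝ) (t : ℕ) :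
    expDeviation v θ B M V (t + 1) = expDeviation v θ B M V t *
      if M t ≤ B t then Real.exp (θ * (V t - v) - θ ^ 2 / 8) else 1 := by
  unfold expDeviation obsDeviation numObs
  rw [Finset.sum_range_succ, Finset.sum_range_succ]
  split_ifs
  · rw [← Real.exp_add]
    congr 1
    push_cast
    ring
  · simp

theorem expDeviation_congr (v θ : ℝ) {B B' V V' : ℕ → ℝ} (M : ℕ → ℝ) {t : ℕ}
    (hB : ∀ s < t, B s = B' s) (hV : ∀ s < t, V s = V' s) :
    expDeviation v θ B M V t = expDeviation v θ B' M V' t := by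
  unfold expDeviation obsDeviation
  rw [numObs_congr M hB]
  congr 3
  refine Finset.sum_congr rfl fun s hs => ?_
  rw [hB s (Finset.mem_range.1 hs), hV s (Finset.mem_range.1 hs)]

end Pathwise

/-! ### Measurability of the statistics and bids -/

section Measurability

variable {α : Type*} [MeasurableSpace α] {B M V : ℕ → α → ℝ}

theorem measurable_numObs {t : ℕ} (hB : ∀ s < t, Measurable (B s)) (hM : ∀ s, Measurable (M s)) :
    Measurable fun x => (numObs (fun s => B s x) (fun s => M s x) t : ℝ) := by
  unfold numObs
  push_cast
  refine Finset.measurable_sum _ fun s hs => ?_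
  exact Measurable.ite (measurableSet_le (hM s) (hB s (Finset.mem_range.1 hs))) measurable_const
    measurable_const

theorem measurable_obsDeviation (v : ℝ) {t : ℕ} (hB : ∀ s < t, Measurable (B s))
    (hM : ∀ s, Measurable (M s)) (hV : ∀ s, Measurable (V s)) :
    Measurable fun x => obsDeviation v (fun s => B s x) (fun s => M s x) (fun s => V s x) t := by
  unfold obsDeviation
  refine Finset.measurable_sum _ fun s hs => ?_
  exact Measurable.ite (measurableSet_le (hM s) (hB s (Finset.mem_range.1 hs)))
    ((hV s).sub_const v) measurable_const

theorem measurable_empMean {t : ℕ} (hB : ∀ s < t, Measurable (B s))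
    (hM : ∀ s, Measurable (M s)) (hV : ∀ s, Measurable (V s)) :
    Measurable fun x => empMean (fun s => B s x) (fun s => M s x) (fun s => V s x) t := by
  unfold empMean
  refine Measurable.div (Finset.measurable_sum _ fun s hs => ?_) (measurable_numObs hB hM)
  exact Measurable.ite (measurableSet_le (hM s) (hB s (Finset.mem_range.1 hs)))
    (hV s) measurable_const

theorem measurable_bonus (γ : ℝ) {t : ℕ} (hB : ∀ s < t, Measurable (B s))
    (hM : ∀ s, Measurable (M s)) :
    Measurable fun x => bonus γ (fun s => B s x) (fun s => M s x) t := by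
  unfold bonus
  exact (((measurable_numObs hB hM).const_mul 2).const_div _).sqrt

theorem measurable_expDeviation (v θ : ℝ) {t : ℕ} (hB : ∀ s < t, Measurable (B s))
    (hM : ∀ s, Measurable (M s)) (hV : ∀ s, Measurable (V s)) :
    Measurable fun x => expDeviation v θ (fun s => B s x) (fun s => M s x) (fun s => V s x) t := by
  unfold expDeviation
  exact (((measurable_obsDeviation v hB hM hV).const_mul θ).sub
    ((measurable_numObs hB hM).const_mul _)).exp

theorem measurable_ucbid1Process {F : ℝ → ℝ} (γ : ℝ) (hF : Measurable (optimalBid F))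
    (hM : ∀ s, Measurable (M s)) (hV : ∀ s, Measurable (V s)) (t : ℕ) :
    Measurable (ucbid1Process F γ V M t) := by
  induction t using Nat.strong_induction_on with
  | _ t ih =>
    unfold ucbid1Process
    cases t with
    | zero => simp only [ucbid1_zero]; exact measurable_const
    | succ t =>
      simp only [ucbid1_succ]
      exact hF.comp ((measurable_empMean ih hM hV).add (measurable_bonus γ ih hM))

end Measurability

/-! ### Independence and the exponential supermartingale -/

section Independence

variable {Ω : Type*} [MeasurableSpace Ω] {P : Measure Ω} [IsProbabilityMeasure P]

theorem indepFun_prodMk_of_indepFun {α β δ : Type*} [MeasurableSpace α] [MeasurableSpace β]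
    [MeasurableSpace δ] {X : Ω → α} {Y : Ω → β} {Z : Ω → δ} (hX : Measurable X)
    (hY : Measurable Y) (hZ : Measurable Z) (hXY : IndepFun X Y P)
    (hXYZ : IndepFun (fun ω => (X ω, Y ω)) Z P) : IndepFun X (fun ω => (Y ω, Z ω)) P := by
  have hYZ : IndepFun Y Z P := hXYZ.comp (φ := Prod.snd) (ψ := id) measurable_snd measurable_id
  have h1 := (indepFun_iff_map_prod_eq_prod_map_map hX.aemeasurable hY.aemeasurable).1 hXY
  have h2 := (indepFun_iff_map_prod_eq_prod_map_map hY.aemeasurable hZ.aemeasurable).1 hYZ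
  have h3 := (indepFun_iff_map_prod_eq_prod_map_map (hX.prodMk hY).aemeasurable
    hZ.aemeasurable).1 hXYZ
  have := Measure.isProbabilityMeasure_map (μ := P) hX.aemeasurable
  have := Measure.isProbabilityMeasure_map (μ := P) hY.aemeasurable
  have := Measure.isProbabilityMeasure_map (μ := P) hZ.aemeasurable
  rw [indepFun_iff_map_prod_eq_prod_map_map hX.aemeasurable (hY.prodMk hZ).aemeasurable, h2,
    ← Measure.prodAssoc_prod, ← h1, ← h3, Measure.map_map (MeasurableEquiv.measurable _)
      ((hX.prodMk hY).prodMk hZ)]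
  rfl

variable {v : ℝ} {μ : Measure ℝ} {V M : ℕ → Ω → ℝ}

/-- The values, with those from round `t` on replaced by `0`. -/
def valuesBefore (V : ℕ → Ω → ℝ) (t s : ℕ) (ω : Ω) : ℝ := if s < t then V s ω else 0

/-- The whole sequence `M` is included because winning round t depends on `M t` as well as on the
past. -/
theorem IsEnvironment.indepFun_past (h : IsEnvironment P v μ V M) (t : ℕ) :
    IndepFun (V t) (fun ω => ((fun s => valuesBefore V t s ω), fun s => M s ω)) P := by
  have hVt := h.measurable_V
  have htrunc : Measurable fun (x : ℕ → ℝ) (s : ℕ) => if s < t then x s else 0 := by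
    refine measurable_pi_lambda _ fun s => ?_
    split_ifs
    · exact measurable_pi_apply s
    · exact measurable_const
  have hVm : Measurable fun ω s => V s ω := measurable_pi_lambda _ hVt
  have hMm : Measurable fun ω s => M s ω := measurable_pi_lambda _ h.measurable_M
  refine indepFun_prodMk_of_indepFun (hVt t) (htrunc.comp hVm) hMm ?_ ?_
  · have h1 := h.iIndep_V.indepFun_finset {t} (Finset.range t) (by simp) hVt
    have hφ : Measurable fun x : ({t} : Finset ℕ) → ℝ => x ⟨t, by simp⟩ := measurable_pi_apply _
    have hψ : Measurable fun (x : Finset.range t → ℝ) (s : ℕ) =>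
        if hs : s < t then x ⟨s, Finset.mem_range.2 hs⟩ else 0 := by
      refine measurable_pi_lambda _ fun s => ?_
      split_ifs
      · exact measurable_pi_apply _
      · exact measurable_const
    have h2 := h1.comp hφ hψ
    have h3 : (fun ω s => valuesBefore V t s ω) = (fun (x : Finset.range t → ℝ) (s : ℕ) =>
        if hs : s < t then x ⟨s, Finset.mem_range.2 hs⟩ else 0) ∘ fun ω i => V i ω := by
      funext ω s
      simp [valuesBefore]
    have h4 : IndepFun (V t) (fun ω s => valuesBefore V t s ω) P := by rw [h3]; exact h2
    exact h4
  · exact h.indep_V_M.comp (φ := fun x : ℕ → ℝ => (x t, fun s => if s < t then x s else 0))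
      ((measurable_pi_apply t).prodMk htrunc) measurable_id

/-- Hoeffding's lemma on an interval of length 1, the source of θ²/8. -/
theorem IsEnvironment.lintegral_exp_le (h : IsEnvironment P v μ V M) (θ : ℝ) (t : ℕ) :
    ∫⁻ ω, ENNReal.ofReal (Real.exp (θ * (V t ω - v) - θ ^ 2 / 8)) ∂P ≤ 1 := by
  have hsub := hasSubgaussianMGF_of_mem_Icc (h.measurable_V t).aemeasurable (h.V_mem t)
  rw [h.mean_V t] at hsub
  have hmgf := hsub.mgf_le θ
  have hint := hsub.integrable_exp_mul θ
  have heq : ∀ ω, Real.exp (θ * (V t ω - v) - θ ^ 2 / 8) =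
      Real.exp (θ * (V t ω - v)) * Real.exp (-(θ ^ 2 / 8)) := fun ω => by
    rw [← Real.exp_add]; ring_nf
  simp_rw [heq]
  rw [← ofReal_integral_eq_lintegral_ofReal (hint.mul_const _)
    (Filter.Eventually.of_forall fun ω => by positivity), integral_mul_const]
  refine ENNReal.ofReal_le_one.2 ?_
  calc _ ≤ Real.exp (θ ^ 2 / 8) * Real.exp (-(θ ^ 2 / 8)) := by
        refine mul_le_mul_of_nonneg_right (hmgf.trans_eq ?_) (Real.exp_nonneg _)
        congr 1
        norm_num
        ring
    _ = 1 := by rw [← Real.exp_add]; simp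

/-- The exponential deviation of the values observed by UCBid1 has expectation at most `1`. -/
theorem IsEnvironment.lintegral_expDeviation_le (h : IsEnvironment P v μ V M) {F : ℝ → ℝ} (γ : ℝ)
    (hF : Measurable (optimalBid F)) (θ : ℝ) (t : ℕ) :
    ∫⁻ ω, ENNReal.ofReal (expDeviation v θ (fun s => ucbid1Process F γ V M s ω)
      (fun s => M s ω) (fun s => V s ω) t) ∂P ≤ 1 := by
  induction t with
  | zero => simp [expDeviation, obsDeviation, numObs]
  | succ t ih =>
    set Z : (ℕ → ℝ) × (ℕ → ℝ) → ENNReal := fun x =>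
      ENNReal.ofReal (expDeviation v θ (ucbid1 F γ x.1 x.2) x.2 x.1 t) with hZ
    have hfst : ∀ s, Measurable fun x : (ℕ → ℝ) × (ℕ → ℝ) => x.1 s := fun s =>
      (measurable_pi_apply s).comp measurable_fst
    have hsnd : ∀ s, Measurable fun x : (ℕ → ℝ) × (ℕ → ℝ) => x.2 s := fun s =>
      (measurable_pi_apply s).comp measurable_snd
    have hB : ∀ s, Measurable fun x : (ℕ → ℝ) × (ℕ → ℝ) => ucbid1 F γ x.1 x.2 s :=
      measurable_ucbid1Process γ hF hsnd hfst
    have hZm : Measurable Z :=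
      (measurable_expDeviation v θ (fun s _ => hB s) hsnd hfst).ennreal_ofReal
    set D : Set ((ℕ → ℝ) × (ℕ → ℝ)) := {x | x.2 t ≤ ucbid1 F γ x.1 x.2 t} with hD
    -- Both the win event `D` and the weight `Z` are functions of `past` alone, hence independent of
    -- `V t`.
    have hDm : MeasurableSet D := measurableSet_le (hsnd t) (hB t)
    set past : Ω → (ℕ → ℝ) × (ℕ → ℝ) :=
      fun ω => ((fun s => valuesBefore V t s ω), fun s => M s ω) with hpast
    have hpastm : Measurable past := by
      refine (measurable_pi_lambda _ fun s => ?_).prodMk (measurable_pi_lambda _ h.measurable_M)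
      unfold valuesBefore
      split_ifs
      · exact h.measurable_V s
      · exact measurable_const
    set g : ℝ → ENNReal := fun x => ENNReal.ofReal (Real.exp (θ * (x - v) - θ ^ 2 / 8)) with hg
    have hgm : Measurable g := by fun_prop
    have hVb : ∀ ω, ∀ s < t, V s ω = valuesBefore V t s ω := fun ω s hs => by
      simp [valuesBefore, hs]
    have hBt : ∀ ω, ∀ s ≤ t, ucbid1Process F γ V M s ω = ucbid1 F γ (past ω).1 (past ω).2 s :=
      fun ω s hs => ucbid1_congr _ fun r hr => hVb ω r (hr.trans_le hs)
    have hZt : ∀ ω, ENNReal.ofReal (expDeviation v θ (fun s => ucbid1Process F γ V M s ω)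
        (fun s => M s ω) (fun s => V s ω) t) = Z (past ω) := fun ω => by
      rw [hZ]
      exact congrArg _ (expDeviation_congr v θ _ (fun s hs => hBt ω s hs.le) (hVb ω))
    have hsplit : ∀ ω, ENNReal.ofReal (expDeviation v θ (fun s => ucbid1Process F γ V M s ω)
        (fun s => M s ω) (fun s => V s ω) (t + 1)) =
        Dᶜ.indicator Z (past ω) + g (V t ω) * D.indicator Z (past ω) := fun ω => by
      rw [expDeviation_succ, ENNReal.ofReal_mul (by unfold expDeviation; positivity), hZt, hBt ω t le_rfl]
      by_cases hω : past ω ∈ D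
      · have h1 : M t ω ≤ ucbid1 F γ (past ω).1 (past ω).2 t := hω
        rw [if_pos h1, Set.indicator_of_mem hω, Set.indicator_of_notMem (by simpa using hω),
          zero_add, mul_comm]
      · have h1 : ¬ M t ω ≤ ucbid1 F γ (past ω).1 (past ω).2 t := hω
        rw [if_neg h1, Set.indicator_of_notMem hω, Set.indicator_of_mem (by simpa using hω)]
        simp
    simp_rw [hsplit]
    have hind := (h.indepFun_past t).comp hgm (hZm.indicator hDm)
    have hcm : Measurable fun ω => Dᶜ.indicator Z (past ω) := (hZm.indicator hDm.compl).comp hpastm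
    rw [lintegral_add_left hcm]
    have hmul := lintegral_mul_eq_lintegral_mul_lintegral_of_indepFun
      (hgm.comp (h.measurable_V t)) ((hZm.indicator hDm).comp hpastm) hind
    simp only [Pi.mul_apply, Function.comp_apply] at hmul
    rw [hmul]
    calc _ ≤ ∫⁻ ω, Dᶜ.indicator Z (past ω) ∂P + 1 * ∫⁻ ω, D.indicator Z (past ω) ∂P :=
          add_le_add le_rfl (mul_le_mul_left (h.lintegral_exp_le θ t) _)
      _ = ∫⁻ ω, Z (past ω) ∂P := by
          rw [one_mul, ← lintegral_add_left hcm]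
          refine lintegral_congr fun ω => ?_
          by_cases hω : past ω ∈ D <;> simp [hω]
      _ ≤ 1 := by simpa only [hZt] using ih

end Independence

/-! ### Peeling over the number of observations -/

section Peeling

/-- Ratio of the geometric grid used to peel the number of observations. -/
noncomputable def peelRatio (γ : ℝ) : ℝ := 1 + Real.sqrt ((γ - 1) / (2 * γ))

/-- Bound on the probability that the confidence interval of round `t` fails on a given side. -/
noncomputable def tailBound (γ : ℝ) (t : ℕ) : ℝ :=
  (Real.log t / Real.log (peelRatio γ) + 1) * (t : ℝ) ^ (-((γ + 1) / 2))

variable {γ : ℝ}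

theorem one_lt_peelRatio (hγ : 1 < γ) : 1 < peelRatio γ := by
  have : 0 < Real.sqrt ((γ - 1) / (2 * γ)) :=
    Real.sqrt_pos.2 (div_pos (by linarith) (by linarith))
  unfold peelRatio
  linarith

/-- The ratio is chosen so that discretizing the exponent degrades γ only to the midpoint (γ + 1)/2,
still above 1. -/
theorem mul_one_sub_peelRatio (hγ : 1 < γ) :
    γ * (1 - (peelRatio γ - 1) ^ 2) = (γ + 1) / 2 := by
  have h : (peelRatio γ - 1) ^ 2 = (γ - 1) / (2 * γ) := by
    rw [peelRatio, add_sub_cancel_left, Real.sq_sqrt (div_nonneg (by linarith) (by linarith))]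
  rw [h]
  have : γ ≠ 0 := by linarith
  field_simp
  ring

theorem tailBound_nonneg (hγ : 1 < γ) (t : ℕ) : 0 ≤ tailBound γ t := by
  have h1 := Real.log_natCast_nonneg t
  have h2 := Real.log_pos (one_lt_peelRatio hγ)
  unfold tailBound
  positivity

theorem summable_tailBound (hγ : 1 < γ) : Summable (tailBound γ) := by
  have hr := Real.log_pos (one_lt_peelRatio hγ)
  -- With log t ≤ t^δ / δ, this δ leaves the power -(γ + 3)/4 < -1.
  set δ := (γ - 1) / 4 with hδ
  have hδ0 : 0 < δ := by simp only [hδ]; linarith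
  have hs : Summable fun t : ℕ => (1 / δ / Real.log (peelRatio γ)) * (t : ℝ) ^ (-((γ + 3) / 4)) +
      (t : ℝ) ^ (-((γ + 1) / 2)) :=
    ((Real.summable_nat_rpow.2 (by linarith)).mul_left _).add
      (Real.summable_nat_rpow.2 (by linarith))
  refine hs.of_nonneg_of_le (tailBound_nonneg hγ) fun t => ?_
  rcases Nat.eq_zero_or_pos t with rfl | ht
  · have h1 : -((γ + 1) / 2) ≠ 0 := by linarith
    have h2 : -((γ + 3) / 4) ≠ 0 := by linarith
    simp [tailBound, Real.zero_rpow h1, Real.zero_rpow h2]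
  have ht0 : (0 : ℝ) < t := by exact_mod_cast ht
  have hlog := Real.log_le_rpow_div ht0.le hδ0
  unfold tailBound
  rw [add_mul, one_mul]
  refine add_le_add ?_ le_rfl
  have hsplit : (t : ℝ) ^ (-((γ + 3) / 4)) = (t : ℝ) ^ δ * (t : ℝ) ^ (-((γ + 1) / 2)) := by
    rw [← Real.rpow_add ht0]; congr 1; simp only [hδ]; ring
  rw [hsplit, ← mul_assoc]
  gcongr
  calc Real.log t / Real.log (peelRatio γ) ≤ (t : ℝ) ^ δ / δ / Real.log (peelRatio γ) := by gcongr
    _ = _ := by ring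

/-- A deviation of order `√n` is detected by one of the exponents of a geometric grid. -/
theorem exists_peel (hγ : 1 < γ) {t n : ℕ} (hn : 1 ≤ n) (hnt : n ≤ t) {S : ℝ}
    (hS : Real.sqrt (γ * Real.log t / 2) * Real.sqrt n ≤ S) :
    ∃ k ∈ Finset.range (⌊Real.log t / Real.log (peelRatio γ)⌋₊ + 1),
      (γ + 1) / 2 * Real.log t ≤
        (4 * Real.sqrt (γ * Real.log t / 2) / peelRatio γ ^ k) * S -
          (4 * Real.sqrt (γ * Real.log t / 2) / peelRatio γ ^ k) ^ 2 / 8 * n := by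
  have hr := one_lt_peelRatio hγ
  have hα := mul_one_sub_peelRatio hγ
  set r := peelRatio γ with hr_def
  have hL := Real.log_natCast_nonneg t
  have hs1 : 1 ≤ Real.sqrt n := Real.one_le_sqrt.2 (by exact_mod_cast hn)
  -- The ideal exponent is 4y/√n, with y = √(γ log t / 2); √n is replaced by the grid point r^k just
  -- below it.
  obtain ⟨k, hk1, hk2⟩ := exists_nat_pow_near hs1 hr
  have hrk : 0 < r ^ k := by positivity
  refine ⟨k, ?_, ?_⟩
  · rw [Finset.mem_range, Nat.lt_succ_iff]
    refine Nat.le_floor ?_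
    rw [le_div_iff₀ (Real.log_pos hr), ← Real.log_pow]
    refine Real.log_le_log hrk (hk1.trans ?_)
    have h1 : (1 : ℝ) ≤ n := by exact_mod_cast hn
    have h2 : (n : ℝ) ≤ t := by exact_mod_cast hnt
    exact (Real.sqrt_le_iff.2 ⟨by linarith, by nlinarith⟩)
  · set y := Real.sqrt (γ * Real.log t / 2) with hy
    have hy2 : y ^ 2 = γ * Real.log t / 2 :=
      Real.sq_sqrt (by have : 0 < γ := by linarith
                       positivity)
    set x := Real.sqrt n / r ^ k with hx
    have hx1 : 1 ≤ x := (one_le_div hrk).2 hk1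
    have hx2 : x ≤ r := by
      rw [hx, div_le_iff₀ hrk, ← pow_succ']; exact hk2.le
    have hy0 : 0 ≤ y := Real.sqrt_nonneg _
    have hnx : (n : ℝ) = (x * r ^ k) ^ 2 := by
      rw [hx, div_mul_cancel₀ _ hrk.ne', Real.sq_sqrt (by positivity)]
    have hSx : y * (x * r ^ k) ≤ S := by
      rw [hx, div_mul_cancel₀ _ hrk.ne']; exact hS
    have hθ : 0 ≤ 4 * y / r ^ k := by positivity
    have h1 := mul_le_mul_of_nonneg_left hSx hθ
    have h2 : 4 * y / r ^ k * (y * (x * r ^ k)) = 4 * y ^ 2 * x := by field_simp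
    have h3 : (4 * y / r ^ k) ^ 2 / 8 * n = 2 * y ^ 2 * x ^ 2 := by rw [hnx]; field_simp; ring
    rw [h3]
    rw [h2] at h1
    have h4 : (x - 1) ^ 2 ≤ (r - 1) ^ 2 := pow_le_pow_left₀ (by linarith) (by linarith) 2
    -- With x = √n / r^k in [1, r], the exponent is at least 4y²x - 2y²x² = 2y²(1 - (x - 1)²).
    have h5 := mul_le_mul_of_nonneg_left h4 (sq_nonneg y)
    have h6 : (γ + 1) / 2 * Real.log t = 2 * y ^ 2 * (1 - (r - 1) ^ 2) := by
      rw [hy2, ← hα]; ring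
    rw [h6]
    nlinarith

end Peeling

/-! ### Self-normalized concentration -/

section Concentration

variable {Ω : Type*} [MeasurableSpace Ω] {P : Measure Ω} [IsProbabilityMeasure P]
  {v γ : ℝ} {μ : Measure ℝ} {V M : ℕ → Ω → ℝ} {F : ℝ → ℝ}

theorem numObs_le (B M : ℕ → ℝ) (t : ℕ) : numObs B M t ≤ t := by
  unfold numObs
  calc _ ≤ ∑ s ∈ Finset.range t, 1 := Finset.sum_le_sum fun s _ => by split_ifs <;> simp
    _ = t := by simp

theorem bonus_mul_numObs (hγ : 0 < γ) (B M : ℕ → ℝ) (t : ℕ) (hN : 1 ≤ numObs B M t) :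
    bonus γ B M t * numObs B M t =
      Real.sqrt (γ * Real.log t / 2) * Real.sqrt (numObs B M t) := by
  have hN' : (0 : ℝ) < numObs B M t := by positivity
  have hL := Real.log_natCast_nonneg t
  rw [bonus, ← div_div, Real.sqrt_div (by positivity), div_mul_eq_mul_div, mul_div_assoc,
    Real.div_sqrt]

/-- Self-normalized deviation bound for the values observed by UCBid1, on the side given by the
sign `σ`. -/
theorem IsEnvironment.measure_deviation_le (h : IsEnvironment P v μ V M) (hγ : 1 < γ)
    (hF : Measurable (optimalBid F)) {σ : ℝ} (hσ : σ ^ 2 = 1) {t : ℕ} (ht : 1 ≤ t) :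
    P.real {ω | 1 ≤ numObs (fun s => ucbid1Process F γ V M s ω) (fun s => M s ω) t ∧
      bonus γ (fun s => ucbid1Process F γ V M s ω) (fun s => M s ω) t ≤
        σ * (empMean (fun s => ucbid1Process F γ V M s ω) (fun s => M s ω) (fun s => V s ω) t - v)}
      ≤ tailBound γ t := by
  have hr := Real.log_pos (one_lt_peelRatio hγ)
  have hL := Real.log_natCast_nonneg t
  have ht0 : (0 : ℝ) < t := by exact_mod_cast ht
  set K := ⌊Real.log t / Real.log (peelRatio γ)⌋₊ + 1 with hK
  set θ : ℕ → ℝ := fun k => 4 * Real.sqrt (γ * Real.log t / 2) / peelRatio γ ^ k with hθ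
  set α := (γ + 1) / 2 with hα
  set Z : ℕ → Ω → ℝ := fun k ω => expDeviation v (σ * θ k) (fun s => ucbid1Process F γ V M s ω)
    (fun s => M s ω) (fun s => V s ω) t with hZ
  have hZm : ∀ k, Measurable (Z k) := fun k => measurable_expDeviation v _
    (fun s _ => measurable_ucbid1Process γ hF h.measurable_M h.measurable_V s) h.measurable_M
    h.measurable_V
  have hpow : (0 : ℝ) < (t : ℝ) ^ α := Real.rpow_pos_of_pos ht0 _
  -- Markov's inequality for each exponent of the grid; a union bound over the grid then gives
  -- `tailBound`.
  have hslice : ∀ k, P {ω | ENNReal.ofReal ((t : ℝ) ^ α) ≤ ENNReal.ofReal (Z k ω)} ≤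
      ENNReal.ofReal ((t : ℝ) ^ (-α)) := fun k => by
    refine (meas_ge_le_lintegral_div (hZm k).ennreal_ofReal.aemeasurable
      (by simpa using hpow) ENNReal.ofReal_ne_top).trans ?_
    rw [Real.rpow_neg ht0.le, ENNReal.ofReal_inv_of_pos hpow, ← one_div]
    exact ENNReal.div_le_div_right (h.lintegral_expDeviation_le γ hF (σ * θ k) t) _
  have hsub : {ω | 1 ≤ numObs (fun s => ucbid1Process F γ V M s ω) (fun s => M s ω) t ∧
      bonus γ (fun s => ucbid1Process F γ V M s ω) (fun s => M s ω) t ≤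
        σ * (empMean (fun s => ucbid1Process F γ V M s ω) (fun s => M s ω) (fun s => V s ω) t - v)}
      ⊆ ⋃ k ∈ Finset.range K,
        {ω | ENNReal.ofReal ((t : ℝ) ^ α) ≤ ENNReal.ofReal (Z k ω)} := by
    rintro ω ⟨hN, hdev⟩
    have h1 := mul_le_mul_of_nonneg_right hdev (Nat.cast_nonneg' (α := ℝ)
      (numObs (fun s => ucbid1Process F γ V M s ω) (fun s => M s ω) t))
    rw [bonus_mul_numObs (by linarith) _ _ _ hN, mul_assoc, empMean_sub_mul_numObs _ _ _ _ _ hN]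
      at h1
    obtain ⟨k, hk, hpeel⟩ := exists_peel hγ hN (numObs_le _ _ t) h1
    simp only [Set.mem_iUnion]
    refine ⟨k, hk, ENNReal.ofReal_le_ofReal ?_⟩
    simp only [hZ, expDeviation]
    rw [Real.rpow_def_of_pos ht0, Real.exp_le_exp, mul_pow, hσ, one_mul]
    calc Real.log t * α = α * Real.log t := mul_comm _ _
      _ ≤ _ := hpeel
      _ = _ := by simp only [hθ]; ring
  refine ENNReal.toReal_le_of_le_ofReal (tailBound_nonneg hγ t) ?_
  calc P _ ≤ P (⋃ k ∈ Finset.range K,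
        {ω | ENNReal.ofReal ((t : ℝ) ^ α) ≤ ENNReal.ofReal (Z k ω)}) := measure_mono hsub
    _ ≤ ∑ k ∈ Finset.range K, ENNReal.ofReal ((t : ℝ) ^ (-α)) :=
        (measure_biUnion_finset_le _ _).trans (Finset.sum_le_sum fun k _ => hslice k)
    _ = ENNReal.ofReal (K * (t : ℝ) ^ (-α)) := by
        rw [Finset.sum_const, Finset.card_range, nsmul_eq_mul,
          ENNReal.ofReal_mul (Nat.cast_nonneg _), ENNReal.ofReal_natCast]
    _ ≤ ENNReal.ofReal (tailBound γ t) := by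
        refine ENNReal.ofReal_le_ofReal (mul_le_mul_of_nonneg_right ?_ (Real.rpow_nonneg ht0.le _))
        rw [hK]
        push_cast
        linarith [Nat.floor_le (div_nonneg hL hr.le)]

end Concentration

/-! ### Underbids, number of wins and loss per round -/

section Regret

variable {v γ c C Δ lam : ℝ} {μ : Measure ℝ}

theorem measurable_optimalBid_cdf (h₁ : PseudoMHR (cdf μ)) : Measurable (optimalBid (cdf μ)) :=
  (monotone_optimalBid h₁.contDiffOn.continuousOn (monotone_cdf μ)).measurable

theorem ucbid1Process_mem {Ω : Type*} {V M : ℕ → Ω → ℝ} (h₁ : PseudoMHR (cdf μ)) (t : ℕ) (ω : Ω) :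
    ucbid1Process (cdf μ) γ V M t ω ∈ Set.Icc (0 : ℝ) 1 := by
  unfold ucbid1Process
  cases t with
  | zero => simp [ucbid1_zero]
  | succ t => rw [ucbid1_succ]; exact optimalBid_mem h₁.contDiffOn.continuousOn _

variable {Ω : Type*} [MeasurableSpace Ω] {P : Measure Ω} {V M : ℕ → Ω → ℝ}

/-- The first bid wins, so there is always an observation. -/
theorem IsEnvironment.ae_one_le_numObs (h : IsEnvironment P v μ V M)
    (hμ : ∀ᵐ m ∂μ, m ∈ Set.Icc (0 : ℝ) 1) (F : ℝ → ℝ) (γ : ℝ) {t : ℕ} (ht : 1 ≤ t) :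
    ∀ᵐ ω ∂P, 1 ≤ numObs (fun s => ucbid1Process F γ V M s ω) (fun s => M s ω) t := by
  have h0 : ∀ᵐ ω ∂P, M 0 ω ∈ Set.Icc (0 : ℝ) 1 := by
    rw [← h.law_M 0] at hμ
    exact ae_of_ae_map (h.measurable_M 0).aemeasurable hμ
  filter_upwards [h0] with ω hω
  have h1 : (if M 0 ω ≤ ucbid1Process F γ V M 0 ω then 1 else 0) ≤
      numObs (fun s => ucbid1Process F γ V M s ω) (fun s => M s ω) t :=
    Finset.single_le_sum
      (f := fun s => if M s ω ≤ ucbid1Process F γ V M s ω then (1 : ℕ) else 0)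
      (fun _ _ => Nat.zero_le _) (Finset.mem_range.2 ht)
  rwa [if_pos (by unfold ucbid1Process; rw [ucbid1_zero]; exact hω.2)] at h1

theorem IsEnvironment.measureReal_le_eq_cdf [IsProbabilityMeasure μ] (h : IsEnvironment P v μ V M) (s : ℕ) (b : ℝ) :
    P.real {ω | M s ω ≤ b} = cdf μ b := by
  rw [cdf_eq_real, ← h.law_M s, map_measureReal_apply (h.measurable_M s) measurableSet_Iic]
  rfl

variable [IsProbabilityMeasure P]

theorem integrable_utility_ucbid1Process (h₁ : PseudoMHR (cdf μ)) (hv : v ∈ Set.Icc (0 : ℝ) 1)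
    (h : IsEnvironment P v μ V M) (t : ℕ) :
    Integrable (fun ω => utility v (cdf μ) (ucbid1Process (cdf μ) γ V M t ω)) P := by
  have hB := measurable_ucbid1Process γ (measurable_optimalBid_cdf h₁) h.measurable_M
    h.measurable_V t
  refine Integrable.of_bound (C := 1) (Measurable.aestronglyMeasurable ?_)
    (Filter.Eventually.of_forall fun ω => ?_)
  · exact (measurable_const.sub hB).mul ((monotone_cdf μ).measurable.comp hB)
  · exact abs_utility_le (cdf_nonneg μ) (cdf_le_one μ) hv (ucbid1Process_mem h₁ t ω)

/-- Underbidding with respect to the optimal bid is unlikely. -/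
theorem IsEnvironment.measure_underbid_le (h : IsEnvironment P v μ V M)
    (hμ : ∀ᵐ m ∂μ, m ∈ Set.Icc (0 : ℝ) 1) (h₁ : PseudoMHR (cdf μ)) (hγ : 1 < γ) (t : ℕ) :
    P.real {ω | ucbid1Process (cdf μ) γ V M t ω < optimalBid (cdf μ) v} ≤ tailBound γ t := by
  cases t with
  | zero =>
    have : {ω | ucbid1Process (cdf μ) γ V M 0 ω < optimalBid (cdf μ) v} = ∅ := by
      ext ω
      simpa [ucbid1Process, ucbid1_zero] using (optimalBid_mem h₁.contDiffOn.continuousOn v).2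
    rw [this, measureReal_empty]
    exact tailBound_nonneg hγ 0
  | succ t =>
    refine le_trans (ENNReal.toReal_mono (measure_ne_top _ _) (measure_mono_ae ?_))
      (h.measure_deviation_le hγ (measurable_optimalBid_cdf h₁) (σ := -1) (by norm_num)
        (Nat.le_add_left 1 t))
    filter_upwards [h.ae_one_le_numObs hμ (cdf μ) γ (Nat.le_add_left 1 t)] with ω hN hω
    refine ⟨hN, ?_⟩
    -- If the upper confidence bound exceeds v, monotonicity of the optimal bid excludes an
    -- underbid.
    by_contra! hcon
    refine absurd hω (not_lt.2 ?_)
    unfold ucbid1Process at hcon ⊢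
    rw [ucbid1_succ]
    exact monotone_optimalBid h₁.contDiffOn.continuousOn (monotone_cdf μ) (by linarith)

/-- UCBid1 wins a positive fraction of the auctions. -/
theorem IsEnvironment.measure_numObs_lt_le [IsProbabilityMeasure μ] (h : IsEnvironment P v μ V M)
    (hμ : ∀ᵐ m ∂μ, m ∈ Set.Icc (0 : ℝ) 1) (h₁ : PseudoMHR (cdf μ)) (hγ : 1 < γ)
    (hpos : 0 < cdf μ (optimalBid (cdf μ) v)) {t : ℕ} (ht : 1 ≤ t) :
    P.real {ω | (numObs (fun s => ucbid1Process (cdf μ) γ V M s ω) (fun s => M s ω) t : ℝ) <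
        cdf μ (optimalBid (cdf μ) v) * t / 2} ≤
      (4 / cdf μ (optimalBid (cdf μ) v) ^ 2 +
        4 * (∑' s, tailBound γ s) / cdf μ (optimalBid (cdf μ) v)) * (t : ℝ)⁻¹ := by
  set b := optimalBid (cdf μ) v with hb
  set p := cdf μ b with hp
  have ht0 : (0 : ℝ) < t := by exact_mod_cast ht
  have hB := measurable_ucbid1Process γ (measurable_optimalBid_cdf h₁) h.measurable_M
    h.measurable_V
  have hwin : ∀ s, MeasurableSet {ω | M s ω ≤ b} := fun s =>
    measurableSet_le (h.measurable_M s) measurable_const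
  have hund : ∀ s, MeasurableSet {ω | ucbid1Process (cdf μ) γ V M s ω < b} := fun s =>
    measurableSet_lt (hB s) measurable_const
  set X : ℕ → Ω → ℝ := fun s => {ω | M s ω ≤ b}.indicator 1 with hX
  set Y : ℕ → Ω → ℝ := fun s => {ω | ucbid1Process (cdf μ) γ V M s ω < b}.indicator 1 with hY
  have hXm : ∀ s, Measurable (X s) := fun s => measurable_one.indicator (hwin s)
  have hX01 : ∀ s ω, X s ω ∈ Set.Icc (0 : ℝ) 1 := fun s ω => by
    simp only [hX, Set.indicator_apply, Pi.one_apply]; split_ifs <;> simp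
  have hXL : ∀ s, MemLp (X s) 2 P := fun s =>
    memLp_of_bounded (a := 0) (b := 1) (Filter.Eventually.of_forall (hX01 s))
      (hXm s).aestronglyMeasurable 2
  have hXmean : ∀ s, ∫ ω, X s ω ∂P = p := fun s => by
    simp only [hX]
    rw [integral_indicator_one (hwin s), h.measureReal_le_eq_cdf]
  have hXind : iIndepFun X P := by
    have hg : Measurable ((Set.Iic b).indicator (1 : ℝ → ℝ)) :=
      measurable_one.indicator measurableSet_Iic
    exact h.iIndep_M.comp (fun _ => (Set.Iic b).indicator (1 : ℝ → ℝ)) fun _ => hg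
  have hYi : ∀ s, Integrable (Y s) P := fun s => (integrable_const (1 : ℝ)).indicator (hund s)
  -- Chebyshev with variance at most t/4. Off this event and the Markov event for `Y`, there are at
  -- least 3pt/4 - pt/4 = pt/2 wins.
  have hcheb : P.real {ω | p * t / 4 ≤ |(∑ s ∈ Finset.range t, X s) ω -
      ∫ ω, (∑ s ∈ Finset.range t, X s) ω ∂P|} ≤ 4 / p ^ 2 * (t : ℝ)⁻¹ := by
    refine ENNReal.toReal_le_of_le_ofReal (by positivity)
      ((meas_ge_le_variance_div_sq (memLp_finsetSum' _ fun s _ => hXL s) (by positivity)).trans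
        (ENNReal.ofReal_le_ofReal ?_))
    rw [IndepFun.variance_sum (fun s _ => hXL s) fun i _ j _ hij => hXind.indepFun hij]
    have hvar : ∑ s ∈ Finset.range t, variance (X s) P ≤ t * (1 / 4) := by
      calc _ ≤ ∑ s ∈ Finset.range t, (1 / 4 : ℝ) := Finset.sum_le_sum fun s _ =>
            (variance_le_sq_of_bounded (Filter.Eventually.of_forall (hX01 s))
              (hXm s).aemeasurable).trans (by norm_num)
        _ = _ := by simp
    calc _ ≤ t * (1 / 4) / (p * t / 4) ^ 2 := by gcongr
      _ = _ := by field_simp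
  have hmarkov : P.real {ω | p * t / 4 ≤ ∑ s ∈ Finset.range t, Y s ω} ≤
      4 * (∑' s, tailBound γ s) / p * (t : ℝ)⁻¹ := by
    have h1 := mul_meas_ge_le_integral_of_nonneg (μ := P)
      (f := fun ω => ∑ s ∈ Finset.range t, Y s ω)
      (Filter.Eventually.of_forall fun ω => Finset.sum_nonneg fun s _ =>
        Set.indicator_nonneg (fun _ _ => zero_le_one) ω)
      (integrable_finsetSum _ fun s _ => hYi s) (p * t / 4)
    rw [integral_finsetSum _ fun s _ => hYi s] at h1
    have h2 : ∑ s ∈ Finset.range t, ∫ ω, Y s ω ∂P ≤ ∑' s, tailBound γ s := by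
      refine le_trans (Finset.sum_le_sum fun s _ => ?_)
        ((summable_tailBound hγ).sum_le_tsum (Finset.range t) fun s _ => tailBound_nonneg hγ s)
      simp only [hY]
      rw [integral_indicator_one (hund s)]
      exact h.measure_underbid_le hμ h₁ hγ s
    have h3 : 0 < p * t / 4 := by positivity
    calc _ ≤ (∑' s, tailBound γ s) / (p * t / 4) := by
          rw [le_div_iff₀ h3, mul_comm]; exact h1.trans h2
      _ = _ := by field_simp
  rw [add_mul]
  refine le_trans (measureReal_mono (fun ω hω => ?_) (measure_ne_top _ _))
    ((measureReal_union_le _ _).trans (add_le_add hcheb hmarkov))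
  by_contra hcon
  simp only [Set.mem_union, Set.mem_ofPred_eq, not_or, not_le] at hcon hω
  obtain ⟨h1, h2⟩ := hcon
  have hmean : ∫ ω, (∑ s ∈ Finset.range t, X s) ω ∂P = p * t := by
    simp only [Finset.sum_apply]
    rw [integral_finsetSum _ fun s _ => (hXL s).integrable one_le_two]
    simp [hXmean, mul_comm]
  rw [hmean] at h1
  have h3 := (abs_lt.1 h1).1
  rw [Finset.sum_apply] at h3
  -- A round with M_s ≤ b* is won unless the bid is below b*.
  have h4 : ∑ s ∈ Finset.range t, (X s ω - Y s ω) ≤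
      numObs (fun s => ucbid1Process (cdf μ) γ V M s ω) (fun s => M s ω) t := by
    unfold numObs
    push_cast
    refine Finset.sum_le_sum fun s _ => ?_
    simp only [hX, hY, Set.indicator_apply, Set.mem_ofPred_eq, Pi.one_apply]
    split_ifs <;> first | (exfalso; linarith) | norm_num
  rw [Finset.sum_sub_distrib] at h4
  linarith

/-- Expected loss of round `t`, once `t` is large. -/
theorem IsEnvironment.integral_loss_le [IsProbabilityMeasure μ] (h : IsEnvironment P v μ V M)
    (hμ : ∀ᵐ m ∂μ, m ∈ Set.Icc (0 : ℝ) 1) (hv : v ∈ Set.Icc (0 : ℝ) 1) (h₁ : PseudoMHR (cdf μ))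
    (h₂ : LocallyRegular (cdf μ) v c C Δ lam) (hγ : 1 < γ)
    (hpos : 0 < cdf μ (optimalBid (cdf μ) v)) {t : ℕ} (ht : 1 ≤ t)
    (hlarge : 4 * γ / cdf μ (optimalBid (cdf μ) v) * (Real.log t / t) ≤ Δ ^ 2) :
    utility v (cdf μ) (optimalBid (cdf μ) v) -
        ∫ ω, utility v (cdf μ) (ucbid1Process (cdf μ) γ V M t ω) ∂P ≤
      4 * tailBound γ t +
      2 * (4 / cdf μ (optimalBid (cdf μ) v) ^ 2 +
        4 * (∑' s, tailBound γ s) / cdf μ (optimalBid (cdf μ) v)) * (t : ℝ)⁻¹ +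
      2 * C * lam * γ / cdf μ (optimalBid (cdf μ) v) * (Real.log t / t) := by
  have hlow := h.measure_deviation_le (F := cdf μ) hγ (measurable_optimalBid_cdf h₁) (σ := -1)
    (by norm_num) ht
  have hup := h.measure_deviation_le (F := cdf μ) hγ (measurable_optimalBid_cdf h₁) (σ := 1)
    (by norm_num) ht
  have hobs := h.measure_numObs_lt_le hμ h₁ hγ hpos ht
  set b := optimalBid (cdf μ) v with hb
  set p := cdf μ b with hp
  set A : Set Ω := {ω | 1 ≤ numObs (fun s => ucbid1Process (cdf μ) γ V M s ω) (fun s => M s ω) t ∧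
      bonus γ (fun s => ucbid1Process (cdf μ) γ V M s ω) (fun s => M s ω) t ≤
        -1 * (empMean (fun s => ucbid1Process (cdf μ) γ V M s ω) (fun s => M s ω)
          (fun s => V s ω) t - v)} with hA
  set A' : Set Ω := {ω | 1 ≤ numObs (fun s => ucbid1Process (cdf μ) γ V M s ω) (fun s => M s ω) t ∧
      bonus γ (fun s => ucbid1Process (cdf μ) γ V M s ω) (fun s => M s ω) t ≤
        1 * (empMean (fun s => ucbid1Process (cdf μ) γ V M s ω) (fun s => M s ω)
          (fun s => V s ω) t - v)} with hA'
  set A'' : Set Ω := {ω | (numObs (fun s => ucbid1Process (cdf μ) γ V M s ω)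
    (fun s => M s ω) t : ℝ) < p * t / 2} with hA''
  have ht0 : (0 : ℝ) < t := by exact_mod_cast ht
  have hL := Real.log_natCast_nonneg t
  have hγ0 : 0 < γ := by linarith
  have hC := h₂.C_pos
  have hlam := h₂.lam_nonneg
  -- A measurable hull has the same probability and an integrable indicator. On it the loss is at
  -- most 2, utilities lying in [-1, 1].
  set E : Set Ω := toMeasurable P (A ∪ A' ∪ A'') with hE
  have hEm : MeasurableSet E := measurableSet_toMeasurable _ _
  have hEP : P.real E ≤ tailBound γ t + tailBound γ t +
      (4 / p ^ 2 + 4 * (∑' s, tailBound γ s) / p) * (t : ℝ)⁻¹ := by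
    have : P.real E = P.real (A ∪ A' ∪ A'') := by
      rw [measureReal_def, measureReal_def, hE, measure_toMeasurable]
    rw [this]
    exact (measureReal_union_le _ _).trans (add_le_add
      ((measureReal_union_le _ _).trans (add_le_add hlow hup)) hobs)
  have hU := integrable_utility_ucbid1Process (γ := γ) h₁ hv h t
  have hloss : ∀ᵐ ω ∂P, utility v (cdf μ) b - utility v (cdf μ) (ucbid1Process (cdf μ) γ V M t ω) ≤
      2 * C * lam * γ / p * (Real.log t / t) + 2 * E.indicator 1 ω := by
    filter_upwards [h.ae_one_le_numObs hμ (cdf μ) γ ht] with ω hN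
    by_cases hω : ω ∈ E
    · have h1 := (abs_le.1 (abs_utility_le (cdf_nonneg μ) (cdf_le_one μ) hv
        (optimalBid_mem h₁.contDiffOn.continuousOn v))).2
      have h2 := (abs_le.1 (abs_utility_le (cdf_nonneg μ) (cdf_le_one μ) hv
        (ucbid1Process_mem (γ := γ) (V := V) (M := M) h₁ t ω))).1
      have h3 : 0 ≤ 2 * C * lam * γ / p * (Real.log t / t) := by positivity
      rw [Set.indicator_of_mem hω, Pi.one_apply]
      linarith
    · rw [Set.indicator_of_notMem hω, mul_zero, add_zero]
      have hω' : ω ∉ A ∪ A' ∪ A'' := fun hmem => hω (subset_toMeasurable _ _ hmem)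
      simp only [hA, hA', hA'', Set.mem_union, Set.mem_ofPred_eq, not_or, not_and, not_le,
        not_lt] at hω'
      obtain ⟨⟨hl, hu⟩, hn⟩ := hω'
      specialize hl hN
      specialize hu hN
      set N := numObs (fun s => ucbid1Process (cdf μ) γ V M s ω) (fun s => M s ω) t with hNdef
      set w := empMean (fun s => ucbid1Process (cdf μ) γ V M s ω) (fun s => M s ω)
        (fun s => V s ω) t with hw
      set ε := bonus γ (fun s => ucbid1Process (cdf μ) γ V M s ω) (fun s => M s ω) t with hε
      have hN0 : (0 : ℝ) < N := by exact_mod_cast hN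
      have hε0 : 0 ≤ ε := Real.sqrt_nonneg _
      have hε2 : ε ^ 2 ≤ γ / p * (Real.log t / t) := by
        rw [hε, bonus, Real.sq_sqrt (by positivity)]
        calc γ * Real.log t / (2 * N) ≤ γ * Real.log t / (p * t) :=
              div_le_div_of_nonneg_left (by positivity) (by positivity) (by linarith)
          _ = _ := by field_simp
      -- `hlarge` keeps the overbid inside the window where the quadratic bound holds.
      have hεΔ : 2 * ε ≤ Δ := by
        refine abs_le_of_sq_le_sq' ?_ h₂.Δ_pos.le |>.2
        calc (2 * ε) ^ 2 = 4 * ε ^ 2 := by ring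
          _ ≤ 4 * (γ / p * (Real.log t / t)) := by linarith
          _ = 4 * γ / p * (Real.log t / t) := by ring
          _ ≤ Δ ^ 2 := hlarge
      have hbid : ucbid1Process (cdf μ) γ V M t ω = optimalBid (cdf μ) (w + ε) := by
        obtain ⟨s, rfl⟩ : ∃ s, t = s + 1 := ⟨t - 1, by omega⟩
        exact ucbid1_succ _ _ _ _ _
      rw [hbid]
      refine (h₂.utility_sub_optimalBid_le h₁ (monotone_cdf μ) (cdf_nonneg μ) hpos
        (by linarith : v ≤ w + ε) (by linarith) hεΔ).trans ?_
      calc 2 * C * lam * ε ^ 2 ≤ 2 * C * lam * (γ / p * (Real.log t / t)) := by gcongr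
        _ = _ := by ring
  have hEi : Integrable (fun ω => 2 * E.indicator (1 : Ω → ℝ) ω) P :=
    ((integrable_const (1 : ℝ)).indicator hEm).const_mul 2
  have hint := integral_mono_ae ((integrable_const _).sub hU)
    ((integrable_const _).add hEi) hloss
  simp only [Pi.sub_apply, Pi.add_apply] at hint
  rw [integral_sub (integrable_const _) hU, integral_add (integrable_const _) hEi,
    integral_const_mul 2, integral_indicator_one hEm] at hint
  simp only [integral_const, probReal_univ, one_smul] at hint
  linarith

end Regret

/-! ### Logarithmic sums and the regret bound -/

theorem sum_range_inv_le {T : ℕ} (hT : 1 ≤ T) :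
    ∑ t ∈ Finset.range T, (t : ℝ)⁻¹ ≤ 1 + Real.log T := by
  obtain ⟨n, rfl⟩ : ∃ n, T = n + 1 := ⟨T - 1, by omega⟩
  rw [Finset.sum_range_succ']
  have h1 := harmonic_le_one_add_log n
  simp only [harmonic, Rat.cast_sum, Rat.cast_inv, Rat.cast_natCast] at h1
  have h2 : Real.log n ≤ Real.log (n + 1 : ℕ) := by
    rcases Nat.eq_zero_or_pos n with rfl | hn
    · simp
    · exact Real.log_le_log (by exact_mod_cast hn) (by push_cast; linarith)
  simp only [Nat.cast_zero, inv_zero, add_zero]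
  linarith

theorem sum_range_log_div_le {T : ℕ} (hT : 1 ≤ T) :
    ∑ t ∈ Finset.range T, Real.log t / t ≤ Real.log T * (1 + Real.log T) := by
  calc ∑ t ∈ Finset.range T, Real.log t / t
      ≤ ∑ t ∈ Finset.range T, Real.log T * (t : ℝ)⁻¹ := by
        refine Finset.sum_le_sum fun t ht => ?_
        rcases Nat.eq_zero_or_pos t with rfl | ht0
        · simp
        rw [div_eq_mul_inv]
        have : Real.log t ≤ Real.log T := Real.log_le_log (by exact_mod_cast ht0)
          (by exact_mod_cast (Finset.mem_range.1 ht).le)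
        gcongr
    _ = Real.log T * ∑ t ∈ Finset.range T, (t : ℝ)⁻¹ := by rw [Finset.mul_sum]
    _ ≤ _ := mul_le_mul_of_nonneg_left (sum_range_inv_le hT) (Real.log_natCast_nonneg T)

theorem exists_forall_mul_log_div_le (a : ℝ) {δ : ℝ} (hδ : 0 < δ) :
    ∃ t₀ : ℕ, 1 ≤ t₀ ∧ ∀ t : ℕ, t₀ ≤ t → a * (Real.log t / t) ≤ δ := by
  have h1 : Filter.Tendsto (fun t : ℕ => Real.log t / t) Filter.atTop (nhds 0) := by
    have := (Real.isLittleO_log_id_atTop.tendsto_div_nhds_zero).comp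
      (tendsto_natCast_atTop_atTop (R := ℝ))
    exact this
  have h2 := h1.const_mul a
  rw [mul_zero] at h2
  obtain ⟨t₀, ht₀⟩ := Filter.eventually_atTop.1 (h2.eventually_le_const hδ)
  exact ⟨max t₀ 1, le_max_right _ _, fun t ht => ht₀ t ((le_max_left _ _).trans ht)⟩

end FirstPrice

/-- `K` is quantified before the probability space, hence is uniform in the law of the values.
Integrability is included so that the integrals in the regret are genuine expectations, not the
default 0. -/
theorem mainTheorem3 (μ : Measure ℝ) [IsProbabilityMeasure μ]
    (hμ : ∀ᵐ m ∂μ, m ∈ Set.Icc (0 : ℝ) 1)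
    (v c C Δ lam γ : ℝ) (hv : v ∈ Set.Icc (0 : ℝ) 1)
    (hpos : 0 < cdf μ (FirstPrice.optimalBid (cdf μ) v))
    (h₁ : FirstPrice.PseudoMHR (cdf μ))
    (h₂ : FirstPrice.LocallyRegular (cdf μ) v c C Δ lam)
    (hγ : 1 < γ) :
    ∃ K : ℝ, ∀ (Ω : Type*) [MeasurableSpace Ω] (P : Measure Ω) [IsProbabilityMeasure P]
      (V M : ℕ → Ω → ℝ), FirstPrice.IsEnvironment P v μ V M →
      (∀ t, Integrable (fun ω =>
        FirstPrice.utility v (cdf μ) (FirstPrice.ucbid1Process (cdf μ) γ V M t ω)) P) ∧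
      ∀ T : ℕ, 2 ≤ T →
        FirstPrice.regret P v (cdf μ) (FirstPrice.ucbid1Process (cdf μ) γ V M) T ≤
          2 * γ * lam * C ^ 2 / (cdf μ (FirstPrice.optimalBid (cdf μ) v) * c) * Real.log T ^ 2
            + K * Real.log T := by
  set F : ℝ → ℝ := ⇑(cdf μ) with hF
  set b := FirstPrice.optimalBid F v with hb
  set p := F b with hp
  have hcont := h₁.contDiffOn.continuousOn
  have hc := h₂.c_pos
  have hC := h₂.C_pos
  have hlam := h₂.lam_nonneg
  have hγ0 : 0 < γ := by linarith
  set τ := ∑' s, FirstPrice.tailBound γ s with hτ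
  have hτ_nonneg : 0 ≤ τ := tsum_nonneg (FirstPrice.tailBound_nonneg hγ)
  set κ := 4 / p ^ 2 + 4 * τ / p with hκ
  have hκ0 : 0 ≤ κ := by positivity
  set a := 2 * C * lam * γ / p with ha
  have ha0 : 0 ≤ a := by positivity
  obtain ⟨t₀, ht₀, hlarge⟩ := FirstPrice.exists_forall_mul_log_div_le (4 * γ / p)
    (pow_pos h₂.Δ_pos 2)
  have hlog2 : 0 < Real.log 2 := Real.log_pos one_lt_two
  -- Constant terms are absorbed through log T ≥ log 2; 2κ comes from the harmonic sum, and a from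
  -- log T (1 + log T).
  refine ⟨(2 * t₀ + 4 * τ + 2 * κ) / Real.log 2 + 2 * κ + a, ?_⟩
  intro Ω _ P _ V M h
  have hint := FirstPrice.integrable_utility_ucbid1Process (γ := γ) h₁ hv h
  refine ⟨hint, fun T hT => ?_⟩
  have hmax : sSup (FirstPrice.utility v F '' Set.Icc (0 : ℝ) 1) = FirstPrice.utility v F b := by
    refine IsGreatest.csSup_eq ⟨⟨b, FirstPrice.optimalBid_mem hcont v, rfl⟩, ?_⟩
    rintro _ ⟨x, hx, rfl⟩
    exact FirstPrice.utility_le_utility_optimalBid hcont v hx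
  have hround : ∀ t, FirstPrice.utility v F b -
      ∫ ω, FirstPrice.utility v F (FirstPrice.ucbid1Process F γ V M t ω) ∂P ≤
      (if t < t₀ then 2 else 0) + 4 * FirstPrice.tailBound γ t + 2 * κ * (t : ℝ)⁻¹ +
        a * (Real.log t / t) := by
    intro t
    have htail := FirstPrice.tailBound_nonneg hγ t
    have hL := Real.log_natCast_nonneg t
    split_ifs with htt
    · have h1 := (abs_le.1 (FirstPrice.abs_utility_le (cdf_nonneg μ) (cdf_le_one μ) hv
        (FirstPrice.optimalBid_mem hcont v))).2
      have h2 : -1 ≤ ∫ ω, FirstPrice.utility v F (FirstPrice.ucbid1Process F γ V M t ω) ∂P := by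
        have := integral_mono (integrable_const (-1 : ℝ)) (hint t) fun ω =>
          (abs_le.1 (FirstPrice.abs_utility_le (cdf_nonneg μ) (cdf_le_one μ) hv
            (FirstPrice.ucbid1Process_mem h₁ t ω))).1
        simpa using this
      have h3 : 0 ≤ 2 * κ * (t : ℝ)⁻¹ := by positivity
      have h4 : 0 ≤ a * (Real.log t / t) := by positivity
      linarith
    · rw [zero_add]
      exact h.integral_loss_le hμ hv h₁ h₂ hγ hpos (ht₀.trans (not_lt.1 htt))
        (hlarge t (not_lt.1 htt))
  have hregret : FirstPrice.regret P v F (FirstPrice.ucbid1Process F γ V M) T ≤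
      2 * t₀ + 4 * τ + 2 * κ * (1 + Real.log T) + a * (Real.log T * (1 + Real.log T)) := by
    have h1 : FirstPrice.regret P v F (FirstPrice.ucbid1Process F γ V M) T =
        ∑ t ∈ Finset.range T, (FirstPrice.utility v F b -
          ∫ ω, FirstPrice.utility v F (FirstPrice.ucbid1Process F γ V M t ω) ∂P) := by
      rw [FirstPrice.regret, hmax, Finset.sum_sub_distrib]
      simp
    rw [h1]
    refine (Finset.sum_le_sum fun t _ => hround t).trans ?_
    rw [Finset.sum_add_distrib, Finset.sum_add_distrib, Finset.sum_add_distrib,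
      ← Finset.mul_sum, ← Finset.mul_sum, ← Finset.mul_sum]
    have h2 : ∑ t ∈ Finset.range T, (if t < t₀ then (2 : ℝ) else 0) ≤ 2 * t₀ := by
      rw [← Finset.sum_filter, Finset.sum_const, nsmul_eq_mul, mul_comm]
      have : ((Finset.range T).filter (· < t₀)).card ≤ t₀ := by
        calc _ ≤ (Finset.range t₀).card := Finset.card_le_card fun t ht =>
              Finset.mem_range.2 (Finset.mem_filter.1 ht).2
          _ = t₀ := Finset.card_range _
      gcongr
    have h3 := (FirstPrice.summable_tailBound hγ).sum_le_tsum (Finset.range T)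
      fun s _ => FirstPrice.tailBound_nonneg hγ s
    have h4 := mul_le_mul_of_nonneg_left (FirstPrice.sum_range_inv_le (one_le_two.trans hT))
      (by positivity : 0 ≤ 2 * κ)
    have h5 := mul_le_mul_of_nonneg_left (FirstPrice.sum_range_log_div_le (one_le_two.trans hT)) ha0
    linarith
  have hlogT : Real.log 2 ≤ Real.log T := Real.log_le_log two_pos (by exact_mod_cast hT)
  have hconst : 2 * t₀ + 4 * τ + 2 * κ ≤
      (2 * t₀ + 4 * τ + 2 * κ) / Real.log 2 * Real.log T := by
    rw [div_mul_eq_mul_div, le_div_iff₀ hlog2]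
    exact mul_le_mul_of_nonneg_left hlogT (by positivity)
  -- The argument gives the coefficient without the factor C/c > 1, which is only inserted here.
  have hcoef : a ≤ 2 * γ * lam * C ^ 2 / (p * c) := by
    rw [ha, div_le_div_iff₀ hpos (by positivity)]
    have : 2 * C * lam * γ * p * c ≤ 2 * C * lam * γ * p * C :=
      mul_le_mul_of_nonneg_left h₂.c_lt_C.le (by positivity)
    linarith
  have hsq := mul_le_mul_of_nonneg_right hcoef (sq_nonneg (Real.log T))
  linarith
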